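/- Let $d,r$ be integers with $1\le d\le r\le 2d$. For $m\ge 1$ let $\gamma_m(t)=(t,t^2,\dots,t^m)$ be the moment curve in $\mathbb{R}^m$. For $n\ge r+1$ and reals $t_1<\dots<t_n$ let $C_{r+1}(n)=\operatorname{conv}\{\gamma_{r+1}(t_1),\dots,\gamma_{r+1}(t_n)\}$; for $n\ge r+2$ this is the cyclic $(r+1)$-polytope on $n$ vertices, and for $n=r+1$ it is an $r$-simplex. Let $f_d(C_{r+1}(n))$ be its number of $d$-dimensional faces (the polytope itself is counted if its dimension is $d$). All complexes are finite simplicial complexes; $V(K)$ is the vertex set of $K$, $f_d(K)$ its number of $d$-simplices, and $\|K\|\hookrightarrow X$ means that the polyhedron of $K$ admits a topological embedding into $X$. An embedding into $\mathbb{R}^r$ is linear if it is affine on each simplex. There is a constant $c>0$ depending only on $d$ and $r$ such that the following holds for all $n\ge r+1$ and all $t_1<\dots<t_n$. 1. $f_d(C_{r+1}(n))\ge c\,n^{\lceil r/2\rceil}$. 2. The maximum $M=\max\{f_d(K) : \dim K=d,\ |V(K)|=n,\ \|K\|\hookrightarrow\mathbb{R}^r\}$ exists and satisfies $M\ge f_d(C_{r+1}(n))$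 if $r>d$, $M\ge f_d(C_{r+1}(n))-1$ if $r=d$, and in both cases $M\ge c\,n^{\lceil r/2\rceil}$. 3. These lower bounds are already reached by linear embeddings: there is a complex $K$ with $\dim K=d$ and $|V(K)|=n$ that embeds linearly into $\mathbb{R}^r$ and for which $f_d(K)$ satisfies the lower bounds stated for $M$ in 2. More precisely: (a) If $r>d$, the $d$-skeleton of the boundary complex of $C_{r+1}(n)$ is a $d$-dimensional complex on $n$ vertices that embeds linearly into $\mathbb{R}^r$ and has exactly $f_d(C_{r+1}(n))$ $d$-simplices. (b) If $r=d$ and $n\ge d+2$, the boundary complex of $C_{d+1}(n)$ is a $d$-dimensional complex on $n$ vertices with exactly $f_d(C_{d+1}(n))$ $d$-simplices which embeds into $S^d$; after removing any one of its $d$-simplices it is a $d$-dimensional complex on $n$ vertices that embeds linearly into $\mathbb{R}^d$ and has exactly $f_d(C_{d+1}(n))-1$ $d$-simplices. 4. If $r=d$, the maximum $M'=\max\{f_d(K) : \dim K=d,\ |V(K)|=n,\ \|K\|\hookrightarrow S^d\}$ exists and satisfies $M'\ge f_d(C_{d+1}(n))$ and $M'\ge c\,n^{\lceil d/2\rceil}$.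 -/

import Mathlib

/-- `K` is a `d`-complex: it has a `d`-simplex (a face with `d + 1` vertices) and no simplex of
larger dimension. The vertex set of `K : AbstractSimplicialComplex (Fin n)` has exactly `n`
elements, because every singleton is a face; the empty simplex is not listed among the faces. -/
def HasDimension {n : ℕ} (K : AbstractSimplicialComplex (Fin n)) (d : ℕ) : Prop :=
  (∃ s ∈ K.faces, s.card = d + 1) ∧ ∀ s ∈ K.faces, s.card ≤ d + 1

/-- The number `f_k(K)` of `k`-simplices of `K`. -/
noncomputable def simplexCount {n : ℕ} (K : AbstractSimplicialComplex (Fin n)) (k : ℕ) : ℕ :=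
  {s : Finset (Fin n) | s ∈ K.faces ∧ s.card = k + 1}.ncard

/-- The polyhedron `‖K‖`, realized (with the subspace topology of `ℝⁿ`) by placing the vertices at
the standard basis vectors: the union over the simplices `s` of `K` of the convex hulls of
`{e_i | i ∈ s}`. -/
def polyhedron {n : ℕ} (K : AbstractSimplicialComplex (Fin n)) : Set (Fin n → ℝ) :=
  {x | x ∈ stdSimplex ℝ (Fin n) ∧ ∃ s ∈ K.faces, ∀ i, i ∉ s → x i = 0}

/-- `‖K‖` admits a topological embedding into `X`. -/
def EmbedsInto {n : ℕ} (K : AbstractSimplicialComplex (Fin n)) (X : Type*)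
    [TopologicalSpace X] : Prop :=
  ∃ f : polyhedron K → X, Topology.IsEmbedding f

/-- `K` admits a linear embedding into `ℝ^r`: an embedding of `‖K‖` that is affine on each simplex,
that is, which sends a point with barycentric coordinates `x` to `∑ i, x i • p i`, where `p i` is
the image of the vertex `i`. -/
def LinearlyEmbedsInto {n : ℕ} (K : AbstractSimplicialComplex (Fin n)) (r : ℕ) : Prop :=
  ∃ p : Fin n → EuclideanSpace ℝ (Fin r),
    Topology.IsEmbedding (fun x : polyhedron K => ∑ i, (x : Fin n → ℝ) i • p i)

/-- The set `{f_d(K) | dim K = d, |V(K)| = n, ‖K‖ ↪ X}`. -/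
def embeddableCounts (d n : ℕ) (X : Type*) [TopologicalSpace X] : Set ℕ :=
  {m | ∃ K : AbstractSimplicialComplex (Fin n),
    HasDimension K d ∧ EmbedsInto K X ∧ simplexCount K d = m}

/-- The moment curve `s ↦ (s, s², …, s^m)` in `ℝ^m`. -/
noncomputable def momentCurve (m : ℕ) (s : ℝ) : EuclideanSpace ℝ (Fin m) :=
  WithLp.toLp 2 (fun j : Fin m => s ^ ((j : ℕ) + 1))

/-- The polytope `conv {γ(t_1), …, γ(t_n)}` spanned by points of the moment curve in `ℝ^m`. For
`t_1 < … < t_n` and `m < n` this is the cyclic `m`-polytope on `n` vertices. -/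
noncomputable def cyclicPolytope (m : ℕ) {n : ℕ} (t : Fin n → ℝ) :
    Set (EuclideanSpace ℝ (Fin m)) :=
  convexHull ℝ (Set.range (fun i => momentCurve m (t i)))

/-- `F` is a nonempty face of `P`: the set of points of `P` at which some linear functional
attains its maximum over `P`. The polytope `P` itself is such a face (zero functional). -/
def IsPolytopeFace {m : ℕ} (P F : Set (EuclideanSpace ℝ (Fin m))) : Prop :=
  F.Nonempty ∧ IsExposed ℝ P F

/-- The number `f_k(P)` of `k`-dimensional faces of `P`. -/
noncomputable def polytopeFaceCount {m : ℕ} (P : Set (EuclideanSpace ℝ (Fin m))) (k : ℕ) : ℕ :=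
  {F | IsPolytopeFace P F ∧ Module.finrank ℝ (vectorSpan ℝ F) = k}.ncard

/-- The simplices of the boundary complex of the cyclic polytope, on the vertex set `Fin n`
(with `i` standing for `γ(t_i)`): the vertex sets of the nonempty proper faces. -/
def cyclicBoundary (m : ℕ) {n : ℕ} (t : Fin n → ℝ) : Set (Finset (Fin n)) :=
  {s | ∃ F, IsPolytopeFace (cyclicPolytope m t) F ∧ F ≠ cyclicPolytope m t ∧
    ∀ i, i ∈ s ↔ momentCurve m (t i) ∈ F}

/-! An affine function on `ℝ^m` restricts to the moment curve as a polynomial of degree at most `m`.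
Faces of the cyclic polytope therefore correspond to Gale sets: zero sets, among the nodes, of such
polynomials that are nonnegative at every node. Everything is done with these witnesses, for `m = r
+ 1`.

Counting: for `2k ≤ m`, the squared nodal polynomial of `k` nodes, padded to degree `m`, is a
witness that can be deformed until it vanishes at `m` nodes (`IsGaleSet.exists_facet_superset`). So
every `k`-set lies in a facet, hence in a face with `d + 1` vertices, and double counting with `k =
⌈r/2⌉` gives order `n^k` such faces.

Embedding: if two points of the polyhedron have the same image, their weights yield a functional
`evalSum` on polynomials. Testing it against the witnesses of the two faces forces the weights to
agree (`IsGaleSet.eq_zero_of_evalSum`). This gives injectivity of radial projection to the sphere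
and of the Schlegel projection to `ℝ^r`; compactness turns injectivity into embedding. The case `n =
r + 1`, a simplex, is treated separately. -/

open Polynomial

/-- `s` is the set of zeros among the nodes `t i` of a polynomial of degree at most `m` which is
nonnegative at all the nodes. For `s` nonempty, this says that `s` is the vertex set of a face of
the polytope spanned by the points of the moment curve with parameters `t i`. -/
def IsGaleSet (m : ℕ) {n : ℕ} (t : Fin n → ℝ) (s : Finset (Fin n)) : Prop :=
  ∃ f : ℝ[X], f.natDegree ≤ m ∧ (∀ i, 0 ≤ f.eval (t i)) ∧ ∀ i, f.eval (t i) = 0 ↔ i ∈ s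

/-! ### Affine relations on the moment curve as functionals on polynomials -/

theorem sum_mul_eval_eq_zero_of_pow {ι : Type*} (s : Finset ι) (u w : ι → ℝ) (m : ℕ)
    (h : ∀ j ≤ m, ∑ i ∈ s, w i * u i ^ j = 0) (f : ℝ[X]) (hf : f.natDegree ≤ m) :
    ∑ i ∈ s, w i * f.eval (u i) = 0 := by
  have h1 : ∀ i ∈ s, w i * f.eval (u i) =
      ∑ j ∈ Finset.range (m + 1), f.coeff j * (w i * u i ^ j) := by
    intro i _
    rw [eval_eq_sum_range' (Nat.lt_succ_of_le hf), Finset.mul_sum]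
    exact Finset.sum_congr rfl fun j _ => by ring
  rw [Finset.sum_congr rfl h1, Finset.sum_comm]
  refine Finset.sum_eq_zero fun j hj => ?_
  rw [← Finset.mul_sum, h j (Nat.lt_succ_iff.1 (Finset.mem_range.1 hj)), mul_zero]

/-- Fewer than `m + 2` distinct nodes satisfy no linear relation valid in degree at most `m`. -/
theorem eq_zero_of_sum_mul_eval_eq_zero {ι : Type*} [DecidableEq ι] {s : Finset ι} {u w : ι → ℝ}
    {m : ℕ} (hu : Set.InjOn u s) (hs : s.card ≤ m + 1)
    (h : ∀ f : ℝ[X], f.natDegree ≤ m → ∑ i ∈ s, w i * f.eval (u i) = 0) :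
    ∀ i ∈ s, w i = 0 := by
  intro i hi
  have hd : (Lagrange.basis s u i).natDegree ≤ m := by
    rw [Lagrange.natDegree_basis hu hi]; omega
  have := h _ hd
  rw [Finset.sum_eq_single i] at this
  · simpa [Lagrange.eval_basis_self hu hi] using this
  · intro j hj hji
    rw [Lagrange.eval_basis_of_ne hji.symm hj, mul_zero]
  · exact fun h => absurd hi h

theorem sum_smul_momentCurve_eq_zero {ι : Type*} {s : Finset ι} {u w : ι → ℝ} {m : ℕ}
    (h0 : ∑ i ∈ s, w i = 0) (h : ∑ i ∈ s, w i • momentCurve m (u i) = 0)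
    (f : ℝ[X]) (hf : f.natDegree ≤ m) : ∑ i ∈ s, w i * f.eval (u i) = 0 := by
  refine sum_mul_eval_eq_zero_of_pow s u w m (fun j hj => ?_) f hf
  rcases j with _ | j
  · simpa using h0
  · have := congrArg (fun v : EuclideanSpace ℝ (Fin m) => v ⟨j, hj⟩) h
    simpa [momentCurve] using this

theorem card_le_natDegree_of_eval_eq_zero {ι : Type*} {s : Finset ι} {u : ι → ℝ}
    (hu : Set.InjOn u s) {f : ℝ[X]} (hf : f ≠ 0) (h : ∀ i ∈ s, f.eval (u i) = 0) :
    s.card ≤ f.natDegree := by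
  by_contra hlt
  refine hf (eq_zero_of_degree_lt_of_eval_index_eq_zero _ hu ?_ h)
  exact degree_le_natDegree.trans_lt (by exact_mod_cast not_le.1 hlt)

theorem affineIndependent_momentCurve {ι : Type*} [Fintype ι] {u : ι → ℝ}
    (hu : Function.Injective u) {m : ℕ} (hm : Fintype.card ι ≤ m + 1) :
    AffineIndependent ℝ (fun i => momentCurve m (u i)) := by
  classical
  rw [affineIndependent_iff]
  intro s w h0 h
  refine eq_zero_of_sum_mul_eval_eq_zero hu.injOn (s.card_le_univ.trans hm) ?_
  exact sum_smul_momentCurve_eq_zero h0 h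

theorem finrank_vectorSpan_momentCurve {n m : ℕ} {t : Fin n → ℝ} (ht : Function.Injective t)
    {s : Finset (Fin n)} {d : ℕ} (hs : s.card = d + 1) (hd : d ≤ m) :
    Module.finrank ℝ (vectorSpan ℝ ((fun i => momentCurve m (t i)) '' (s : Set (Fin n)))) = d := by
  have h := affineIndependent_momentCurve (u := fun i : s => t i) (m := m)
    (ht.comp Subtype.val_injective) (by simp [hs, hd])
  have h2 := h.finrank_vectorSpan (n := d) (by simp [hs])
  rw [Set.image_eq_range]
  exact h2

/-- The bound `d < m` is strict because all sets of at least `m + 1` points share the dimension `m`.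
-/
theorem finrank_vectorSpan_momentCurve_eq_iff {n m : ℕ} {t : Fin n → ℝ}
    (ht : Function.Injective t) {s : Finset (Fin n)} (hs : s.Nonempty) {d : ℕ} (hd : d < m) :
    Module.finrank ℝ (vectorSpan ℝ ((fun i => momentCurve m (t i)) '' (s : Set (Fin n)))) = d ↔
      s.card = d + 1 := by
  refine ⟨fun h => ?_, fun h => finrank_vectorSpan_momentCurve ht h hd.le⟩
  by_cases hc : s.card ≤ m + 1
  · obtain ⟨k, hk⟩ : ∃ k, s.card = k + 1 := ⟨s.card - 1, by have := hs.card_pos; omega⟩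
    rw [finrank_vectorSpan_momentCurve ht hk (by omega)] at h
    omega
  · obtain ⟨u, hus, hu⟩ := Finset.exists_subset_card_eq (show m + 1 ≤ s.card by omega)
    have h1 := finrank_vectorSpan_momentCurve ht hu le_rfl
    have h2 := Submodule.finrank_mono (vectorSpan_mono ℝ
      (Set.image_mono (f := fun i => momentCurve m (t i)) (Finset.coe_subset.2 hus)))
    omega

/-! ### Gale sets: simpliciality and neighbourliness -/

namespace IsGaleSet

variable {m n : ℕ} {t : Fin n → ℝ} {s : Finset (Fin n)}

/-- Every subset of a small Gale set is a Gale set: the polytope is simplicial. -/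
theorem subset (ht : Function.Injective t) (hs : IsGaleSet m t s) (hc : s.card ≤ m + 1)
    {s' : Finset (Fin n)} (h : s' ⊆ s) : IsGaleSet m t s' := by
  obtain ⟨f, hfd, hf0, hf⟩ := hs
  -- Interpolate 0 on `s'` and 1 on the rest of `s`. A large multiple of `f`, which vanishes on `s`,
  -- then makes the sum positive off `s`.
  set g := Lagrange.interpolate s t (fun i => if i ∈ s' then 0 else 1) with hg
  have hgd : g.natDegree ≤ m := by
    have := Lagrange.degree_interpolate_lt (fun i => if i ∈ s' then (0 : ℝ) else 1)
      (ht.injOn (s := s))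
    rw [← hg] at this
    by_cases h0 : g = 0
    · simp [h0]
    · have := (natDegree_lt_iff_degree_lt h0).2 this
      omega
  have hgs : ∀ i ∈ s, g.eval (t i) = if i ∈ s' then 0 else 1 := fun i hi =>
    Lagrange.eval_interpolate_at_node _ ht.injOn hi
  have key : ∃ N : ℝ, ∀ i, i ∉ s → 0 < N * f.eval (t i) + g.eval (t i) := by
    have hpos : ∀ i, i ∉ s → 0 < f.eval (t i) := fun i hi =>
      lt_of_le_of_ne (hf0 i) fun h => hi ((hf i).1 h.symm)
    obtain ⟨N, hN⟩ := (Set.finite_range fun i => -g.eval (t i) / f.eval (t i)).bddAbove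
    refine ⟨N + 1, fun i hi => ?_⟩
    have h1 : -g.eval (t i) / f.eval (t i) ≤ N := hN ⟨i, rfl⟩
    rw [div_le_iff₀ (hpos i hi)] at h1
    linarith [hpos i hi]
  obtain ⟨N, hN⟩ := key
  have hval : ∀ i, (0 ≤ (C N * f + g).eval (t i)) ∧ ((C N * f + g).eval (t i) = 0 ↔ i ∈ s') := by
    intro i
    simp only [eval_add, eval_mul, eval_C]
    by_cases hi : i ∈ s
    · rw [(hf i).2 hi, hgs i hi]
      split_ifs with h' <;> simp [h']
    · exact ⟨(hN i hi).le, iff_of_false (hN i hi).ne' fun h' => hi (h h')⟩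
  exact ⟨C N * f + g, (natDegree_add_le _ _).trans (max_le ((natDegree_C_mul_le _ _).trans hfd) hgd),
    fun i => (hval i).1, fun i => (hval i).2⟩

/-- More than `m` zeros force the witness to be the zero polynomial, which vanishes at all nodes. -/
theorem card_le (ht : Function.Injective t) (hs : IsGaleSet m t s) (hu : s ≠ Finset.univ) :
    s.card ≤ m := by
  obtain ⟨f, hfd, hf0, hf⟩ := hs
  by_contra hlt
  refine hu (Finset.eq_univ_iff_forall.2 fun i => (hf i).1 ?_)
  have : f = 0 := by
    by_contra h0
    exact hlt ((card_le_natDegree_of_eval_eq_zero ht.injOn h0 fun i hi => (hf i).2 hi).trans hfd)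
  simp [this]

/-- A monic witness of degree `m` can be moved until its zero set gets larger. -/
theorem exists_larger_of_monic (ht : Function.Injective t) (hn : m ≤ n) {f : ℝ[X]} (hm : f.Monic)
    (hfd : f.natDegree = m) (hf0 : ∀ i, 0 ≤ f.eval (t i)) (hf : ∀ i, f.eval (t i) = 0 ↔ i ∈ s)
    (hc : s.card < m) : ∃ (f' : ℝ[X]) (s' : Finset (Fin n)), f'.Monic ∧ f'.natDegree = m ∧
      (∀ i, 0 ≤ f'.eval (t i)) ∧ (∀ i, f'.eval (t i) = 0 ↔ i ∈ s') ∧ s ⊂ s' := by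
  classical
  have hpos : ∀ i, i ∉ s → 0 < f.eval (t i) := fun i hi =>
    lt_of_le_of_ne (hf0 i) fun h => hi ((hf i).1 h.symm)
  obtain ⟨j, hj⟩ : ∃ j, j ∉ s := by
    by_contra! h
    rw [Finset.eq_univ_iff_forall.2 h, Finset.card_fin] at hc
    omega
  -- The direction of motion is a multiple of the nodal polynomial of `s`, with sign chosen to be
  -- negative at `t j`. Its degree `s.card < m` leaves the leading term of `f` untouched.
  obtain ⟨g, hgd, hgs, hgj⟩ : ∃ g : ℝ[X], g.degree < m ∧ (∀ i ∈ s, g.eval (t i) = 0) ∧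
      g.eval (t j) < 0 := by
    have h0 : (Lagrange.nodal s t).eval (t j) ≠ 0 :=
      Lagrange.eval_nodal_not_at_node fun i hi h => hj (ht h ▸ hi)
    refine ⟨C (-(Lagrange.nodal s t).eval (t j)) * Lagrange.nodal s t, ?_, fun i hi => ?_, ?_⟩
    · rw [← smul_eq_C_mul]
      refine (degree_smul_le _ _).trans_lt ?_
      rw [Lagrange.degree_nodal]
      exact_mod_cast hc
    · simp [Lagrange.eval_nodal_at_node hi]
    · have := mul_self_pos.2 h0
      simp only [eval_mul, eval_C]
      linarith
  -- Ratio test: the smallest ratio is the first time `c` at which `f + c g` acquires a new zero,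
  -- while no node value has become negative.
  obtain ⟨k, hk, hmin⟩ := Finset.exists_min_image
    (Finset.univ.filter fun i => g.eval (t i) < 0) (fun i => f.eval (t i) / -g.eval (t i))
    ⟨j, by simpa using hgj⟩
  simp only [Finset.mem_filter, Finset.mem_univ, true_and] at hk hmin
  set c := f.eval (t k) / -g.eval (t k) with hcdef
  have hc0 : 0 ≤ c := div_nonneg (hf0 k) (by linarith)
  have hcg : (C c * g).degree < f.degree := by
    rw [degree_eq_natDegree hm.ne_zero, hfd, ← smul_eq_C_mul]
    exact (degree_smul_le _ _).trans_lt hgd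
  refine ⟨f + C c * g, Finset.univ.filter fun i => (f + C c * g).eval (t i) = 0,
    hm.add_of_left hcg, ?_, fun i => ?_, fun i => by simp, ?_⟩
  · rw [natDegree_add_eq_left_of_degree_lt hcg, hfd]
  · simp only [eval_add, eval_mul, eval_C]
    rcases lt_or_ge (g.eval (t i)) 0 with hi | hi
    · have := hmin i hi
      rw [le_div_iff₀ (by linarith)] at this
      linarith
    · exact add_nonneg (hf0 i) (mul_nonneg hc0 hi)
  · rw [Finset.ssubset_iff_of_subset]
    · refine ⟨k, ?_, fun hks => hk.ne (hgs k hks)⟩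
      have : g.eval (t k) ≠ 0 := hk.ne
      simp only [eval_add, eval_mul, eval_C, Finset.mem_filter, Finset.mem_univ, true_and, hcdef]
      field_simp
      ring
    · intro i hi
      simp [hgs i hi, (hf i).2 hi]

/-- Monicity keeps the witness nonzero, so its zeros never exceed `m` nodes, and the enlargement
stops exactly at `m`. -/
theorem exists_card_eq_of_monic (ht : Function.Injective t) (hn : m ≤ n) {f : ℝ[X]} (hm : f.Monic)
    (hfd : f.natDegree = m) (hf0 : ∀ i, 0 ≤ f.eval (t i)) (hf : ∀ i, f.eval (t i) = 0 ↔ i ∈ s) :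
    ∃ T, s ⊆ T ∧ T.card = m ∧ IsGaleSet m t T := by
  have hle : s.card ≤ m :=
    hfd ▸ card_le_natDegree_of_eval_eq_zero ht.injOn hm.ne_zero fun i hi => (hf i).2 hi
  induction hk : m - s.card using Nat.strong_induction_on generalizing s f with
  | _ k ih =>
    rcases hle.eq_or_lt with h | h
    · exact ⟨s, subset_rfl, h, f, hfd.le, hf0, hf⟩
    · obtain ⟨f', s', h1, h2, h3, h4, h5⟩ := exists_larger_of_monic ht hn hm hfd hf0 hf h
      have h6 := Finset.card_lt_card h5
      have h7 : s'.card ≤ m :=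
        h2 ▸ card_le_natDegree_of_eval_eq_zero ht.injOn h1.ne_zero fun i hi => (h4 i).2 hi
      obtain ⟨T, hT, hT2⟩ := ih (m - s'.card) (by omega) h1 h2 h3 h4 h7 rfl
      exact ⟨T, h5.subset.trans hT, hT2⟩

/-- Every set of at most `m / 2` vertices lies in the vertex set of a facet. -/
theorem exists_facet_superset (ht : Function.Injective t) (hn : m ≤ n) {S : Finset (Fin n)}
    (hS : 2 * S.card ≤ m) : ∃ T, S ⊆ T ∧ T.card = m ∧ IsGaleSet m t T := by
  obtain ⟨a, ha⟩ : ∃ a, ∀ i, a < t i := by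
    obtain ⟨a, ha⟩ := (Set.finite_range t).bddBelow
    exact ⟨a - 1, fun i => by linarith [ha ⟨i, rfl⟩]⟩
  -- The square is nonnegative with zeros exactly on `S`. The factor in `X - a`, positive at the
  -- nodes since `a` lies to their left, brings the degree to exactly `m`.
  have hmon : (Lagrange.nodal S t ^ 2 * (X - C a) ^ (m - 2 * S.card)).Monic :=
    (Lagrange.nodal_monic.pow 2).mul ((monic_X_sub_C a).pow _)
  refine exists_card_eq_of_monic ht hn hmon ?_ (fun i => ?_) (fun i => ?_)
  · rw [(Lagrange.nodal_monic.pow 2).natDegree_mul ((monic_X_sub_C a).pow _),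
      Lagrange.nodal_monic.natDegree_pow, (monic_X_sub_C a).natDegree_pow, Lagrange.natDegree_nodal,
      natDegree_X_sub_C]
    omega
  · have := ha i
    simp only [eval_mul, eval_pow, eval_sub, eval_X, eval_C]
    exact mul_nonneg (sq_nonneg _) (pow_nonneg (by linarith) _)
  · have h1 : (t i - a) ^ (m - 2 * S.card) ≠ 0 := pow_ne_zero _ (sub_pos.2 (ha i)).ne'
    simp only [eval_mul, eval_pow, eval_sub, eval_X, eval_C, mul_eq_zero, h1, or_false,
      pow_eq_zero_iff two_ne_zero, Lagrange.eval_nodal, Finset.prod_eq_zero_iff, sub_eq_zero,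
      ht.eq_iff]
    simp

/-- Every set of at most `m / 2` vertices lies in a Gale set of any given intermediate size. -/
theorem exists_superset_card_eq (ht : Function.Injective t) (hn : m ≤ n) {S : Finset (Fin n)}
    (hS : 2 * S.card ≤ m) {k : ℕ} (hk : S.card ≤ k) (hkm : k ≤ m) :
    ∃ T, S ⊆ T ∧ T.card = k ∧ IsGaleSet m t T := by
  obtain ⟨T, hST, hT, hG⟩ := exists_facet_superset ht hn hS
  obtain ⟨U, hSU, hUT, hU⟩ := Finset.exists_subsuperset_card_eq hST hk (hT ▸ hkm)
  exact ⟨U, hSU, hU, hG.subset ht (by omega) hUT⟩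

end IsGaleSet

/-- The functional `f ↦ ∑ i, w i * f (u i)` on polynomials. -/
noncomputable def evalSum {ι : Type*} [Fintype ι] (u w : ι → ℝ) : ℝ[X] →ₗ[ℝ] ℝ :=
  ∑ i, w i • leval (u i)

theorem evalSum_apply {ι : Type*} [Fintype ι] (u w : ι → ℝ) (f : ℝ[X]) :
    evalSum u w f = ∑ i, w i * f.eval (u i) := by
  simp [evalSum, leval]

theorem evalSum_eq_zero_of_smul_momentCurve {ι : Type*} [Fintype ι] {u w : ι → ℝ} {m : ℕ}
    (h0 : ∑ i, w i = 0) (h : ∑ i, w i • momentCurve m (u i) = 0)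
    {f : ℝ[X]} (hf : f.natDegree ≤ m) : evalSum u w f = 0 := by
  rw [evalSum_apply]
  exact sum_smul_momentCurve_eq_zero h0 h f hf

theorem IsGaleSet.eq_zero_of_evalSum {m n : ℕ} {t w : Fin n → ℝ} {s : Finset (Fin n)}
    (ht : Function.Injective t) (hs : IsGaleSet m t s) (hc : s.card ≤ m + 1)
    (hw : ∀ i, i ∉ s → w i ≤ 0) (h : ∀ f : ℝ[X], f.natDegree ≤ m → evalSum t w f = 0) :
    w = 0 := by
  classical
  obtain ⟨g, hgd, hg0, hg⟩ := hs
  have hterm : ∀ i ∈ Finset.univ, w i * g.eval (t i) ≤ 0 := by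
    intro i _
    by_cases hi : i ∈ s
    · simp [(hg i).2 hi]
    · exact mul_nonpos_of_nonpos_of_nonneg (hw i hi) (hg0 i)
  have hsum := h g hgd
  rw [evalSum_apply, Finset.sum_eq_zero_iff_of_nonpos hterm] at hsum
  have hoff : ∀ i, i ∉ s → w i = 0 := fun i hi =>
    (mul_eq_zero.1 (hsum i (Finset.mem_univ i))).resolve_right fun h0 => hi ((hg i).1 h0)
  have hon : ∀ i ∈ s, w i = 0 := by
    refine eq_zero_of_sum_mul_eval_eq_zero ht.injOn hc fun f hf => ?_
    rw [← h f hf, evalSum_apply]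
    exact Finset.sum_subset (Finset.subset_univ s) fun i _ hi => by rw [hoff i hi, zero_mul]
  funext i
  by_cases hi : i ∈ s
  · exact hon i hi
  · exact hoff i hi

/-! ### Embeddings by radial and central projection -/

section Embedding

variable {n : ℕ} {K : AbstractSimplicialComplex (Fin n)}

theorem isCompact_polyhedron (K : AbstractSimplicialComplex (Fin n)) :
    IsCompact (polyhedron K) := by
  have h : polyhedron K = ⋃ s ∈ K.faces,
      (stdSimplex ℝ (Fin n) ∩ ⋂ i, ⋂ (_ : i ∉ s), {x | x i = 0}) := by
    ext x
    simp only [polyhedron, Set.mem_ofPred_eq, Set.mem_iUnion, Set.mem_inter_iff, Set.mem_iInter,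
      exists_prop]
    tauto
  rw [h]
  refine (Set.toFinite _).isCompact_biUnion fun s _ => (isCompact_stdSimplex ℝ (Fin n)).inter_right ?_
  exact isClosed_iInter fun i => isClosed_iInter fun _ =>
    isClosed_eq (continuous_apply i) continuous_const

theorem isEmbedding_of_injective_polyhedron {X : Type*} [TopologicalSpace X] [T2Space X]
    {f : polyhedron K → X} (hf : Continuous f) (hi : Function.Injective f) :
    Topology.IsEmbedding f :=
  haveI := isCompact_iff_compactSpace.1 (isCompact_polyhedron K)
  (hf.isClosedEmbedding hi).isEmbedding

theorem LinearlyEmbedsInto.of_injOn {r : ℕ} (p : Fin n → EuclideanSpace ℝ (Fin r))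
    (h : ∀ x ∈ polyhedron K, ∀ y ∈ polyhedron K, ∑ i, (x i - y i) • p i = 0 → x = y) :
    LinearlyEmbedsInto K r := by
  refine ⟨p, isEmbedding_of_injective_polyhedron (continuous_finsetSum _ fun i _ =>
    ((continuous_apply i).comp continuous_subtype_val).smul continuous_const) fun x y hxy => ?_⟩
  refine Subtype.ext (h x x.2 y y.2 ?_)
  simp only [sub_smul, Finset.sum_sub_distrib]
  exact sub_eq_zero.2 hxy

theorem LinearlyEmbedsInto.embedsInto {r : ℕ} (h : LinearlyEmbedsInto K r) :
    EmbedsInto K (EuclideanSpace ℝ (Fin r)) :=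
  let ⟨_, hp⟩ := h
  ⟨_, hp⟩

theorem EmbedsInto.sphere_of_ray_injective {E : Type*} [NormedAddCommGroup E] [NormedSpace ℝ E]
    (v : (Fin n → ℝ) → E) (hv : Continuous v) (h0 : ∀ x ∈ polyhedron K, v x ≠ 0)
    (h : ∀ x ∈ polyhedron K, ∀ y ∈ polyhedron K, ∀ l : ℝ, 0 < l → v x = l • v y → x = y) :
    EmbedsInto K (Metric.sphere (0 : E) 1) := by
  refine ⟨fun x => ⟨‖v x‖⁻¹ • v x, ?_⟩, isEmbedding_of_injective_polyhedron ?_ ?_⟩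
  · have := norm_ne_zero_iff.2 (h0 x x.2)
    simp [norm_smul, this]
  · refine Continuous.subtype_mk (Continuous.smul (Continuous.inv₀ ?_ ?_) ?_) _
    · exact (hv.comp continuous_subtype_val).norm
    · exact fun x => norm_ne_zero_iff.2 (h0 x x.2)
    · exact hv.comp continuous_subtype_val
  · intro x y hxy
    have hx := norm_pos_iff.2 (h0 x x.2)
    have hy := norm_pos_iff.2 (h0 y y.2)
    refine Subtype.ext (h x x.2 y y.2 (‖v x‖ * ‖v y‖⁻¹) (by positivity) ?_)
    have h1 : ‖v x‖⁻¹ • v x = ‖v y‖⁻¹ • v y := congrArg Subtype.val hxy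
    rw [mul_smul, ← h1, smul_smul, mul_inv_cancel₀ hx.ne', one_smul]

theorem linearlyEmbedsInto_of_card_le {r : ℕ} (hn : n ≤ r + 1) : LinearlyEmbedsInto K r := by
  have hu : Function.Injective fun i : Fin n => ((i : ℕ) : ℝ) :=
    fun i j h => Fin.ext (Nat.cast_injective h)
  refine .of_injOn (fun i => momentCurve r (i : ℕ)) fun x hx y hy h => ?_
  have h0 : ∑ i, (x i - y i) = 0 := by
    rw [Finset.sum_sub_distrib, hx.1.2, hy.1.2, sub_self]
  have := eq_zero_of_sum_mul_eval_eq_zero (hu.injOn (s := (Finset.univ : Finset (Fin n))))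
    (by simpa using hn) (sum_smul_momentCurve_eq_zero h0 h)
  exact funext fun i => sub_eq_zero.1 (this i (Finset.mem_univ i))

/-- The standard simplex lies in the hyperplane of coordinate sum 1, which meets each ray from the
origin at most once. -/
theorem embedsInto_sphere_euclideanSpace :
    EmbedsInto K (Metric.sphere (0 : EuclideanSpace ℝ (Fin n)) 1) := by
  refine .sphere_of_ray_injective (fun x => WithLp.toLp 2 x) (by fun_prop) ?_ ?_
  · intro x hx h
    have hx0 : x = 0 := congrArg WithLp.ofLp h
    have := hx.1.2
    simp [hx0] at this
  · intro x hx y hy l _ h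
    have h1 : x = l • y := congrArg WithLp.ofLp h
    have hl : l = 1 := by
      have := hx.1.2
      rwa [h1, Finset.sum_congr rfl fun i _ => Pi.smul_apply l y i, ← Finset.smul_sum, hy.1.2,
        smul_eq_mul, mul_one] at this
    rw [h1, hl, one_smul]

variable {t : Fin n → ℝ}

/-- Radial projection from the barycentre of the vertices. -/
theorem embedsInto_sphere_of_isGaleSet {m : ℕ} (ht : Function.Injective t)
    (hK : ∀ s ∈ K.faces, IsGaleSet m t s ∧ s ≠ Finset.univ) :
    EmbedsInto K (Metric.sphere (0 : EuclideanSpace ℝ (Fin m)) 1) := by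
  rcases Nat.eq_zero_or_pos n with rfl | hn
  · refine .sphere_of_ray_injective (fun _ => 0) continuous_const ?_ ?_ <;>
    · intro x hx
      simpa using hx.1.2
  have hn' : (0 : ℝ) < n := by exact_mod_cast hn
  set b : ℝ := 1 / n with hb
  have hb0 : 0 < b := by positivity
  have hbsum : ∀ x ∈ polyhedron K, ∑ i, (x i - b) = 0 := by
    intro x hx
    rw [Finset.sum_sub_distrib, hx.1.2]
    simp [hb, hn'.ne']
  set v : (Fin n → ℝ) → EuclideanSpace ℝ (Fin m) :=
    fun x => ∑ i, (x i - b) • momentCurve m (t i) with hv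
  -- A supporting hyperplane at `x`: zero at the point itself, positive at the barycentre.
  have hwit : ∀ x ∈ polyhedron K, ∃ g : ℝ[X], g.natDegree ≤ m ∧ (∀ i, 0 ≤ g.eval (t i)) ∧
      evalSum t x g = 0 ∧ 0 < evalSum t (fun _ => b) g := by
    intro x hx
    obtain ⟨s, hs, hxs⟩ := hx.2
    obtain ⟨⟨g, hgd, hg0, hg⟩, hsu⟩ := hK s hs
    refine ⟨g, hgd, hg0, ?_, ?_⟩
    · rw [evalSum_apply]
      refine Finset.sum_eq_zero fun i _ => ?_
      by_cases hi : i ∈ s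
      · rw [(hg i).2 hi, mul_zero]
      · rw [hxs i hi, zero_mul]
    · obtain ⟨j, hj⟩ : ∃ j, j ∉ s := by
        by_contra! h
        exact hsu (Finset.eq_univ_iff_forall.2 h)
      rw [evalSum_apply]
      refine Finset.sum_pos' (fun i _ => mul_nonneg hb0.le (hg0 i)) ⟨j, Finset.mem_univ j, ?_⟩
      exact mul_pos hb0 (lt_of_le_of_ne (hg0 j) fun h => hj ((hg j).1 h.symm))
  have hrel : ∀ x ∈ polyhedron K, ∀ y ∈ polyhedron K, ∀ l : ℝ, v x = l • v y →
      ∀ f : ℝ[X], f.natDegree ≤ m → evalSum t (fun i => (x i - b) - l * (y i - b)) f = 0 := by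
    intro x hx y hy l h f hf
    refine evalSum_eq_zero_of_smul_momentCurve ?_ ?_ hf
    · rw [Finset.sum_sub_distrib, hbsum x hx, ← Finset.mul_sum, hbsum y hy]
      simp
    · simp only [sub_smul (_ - _), mul_smul, Finset.sum_sub_distrib, ← Finset.smul_sum]
      exact sub_eq_zero.2 h
  have hexp : ∀ (x y : Fin n → ℝ) (l : ℝ) (f : ℝ[X]),
      evalSum t (fun i => (x i - b) - l * (y i - b)) f =
        evalSum t x f - evalSum t (fun _ => b) f
          - l * (evalSum t y f - evalSum t (fun _ => b) f) := by
    intro x y l f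
    simp only [evalSum_apply, ← Finset.sum_sub_distrib, Finset.mul_sum]
    exact Finset.sum_congr rfl fun i _ => by ring
  have hnn : ∀ y ∈ polyhedron K, ∀ g : ℝ[X], (∀ i, 0 ≤ g.eval (t i)) → 0 ≤ evalSum t y g := by
    intro y hy g hg
    rw [evalSum_apply]
    exact Finset.sum_nonneg fun i _ => mul_nonneg (hy.1.1 i) (hg i)
  -- Evaluating `v x = l • v y` on the supporting function of `x`, with value `B > 0` at the
  -- barycentre and `Y ≥ 0` at `y`, gives `-B = l (Y - B)`, so `l ≥ 1`. Exchanging `x` and `y` gives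
  -- `l = 1`.
  have hone : ∀ x ∈ polyhedron K, ∀ y ∈ polyhedron K, ∀ l : ℝ, 0 < l → v x = l • v y → 1 ≤ l := by
    intro x hx y hy l hl h
    obtain ⟨g, hgd, hg0, hxg, hbg⟩ := hwit x hx
    have h1 := hrel x hx y hy l h g hgd
    rw [hexp, hxg] at h1
    have h2 := mul_nonneg hl.le (hnn y hy g hg0)
    by_contra! hlt
    nlinarith
  refine .sphere_of_ray_injective v (by fun_prop) ?_ ?_
  · intro x hx h
    obtain ⟨g, hgd, hg0, hxg, hbg⟩ := hwit x hx
    have h1 := hrel x hx x hx 0 (by rw [h, zero_smul]) g hgd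
    rw [hexp, hxg] at h1
    linarith
  · intro x hx y hy l hl h
    have h1 := hone x hx y hy l hl h
    have h2 := hone y hy x hx l⁻¹ (by positivity) (by rw [h, smul_smul, inv_mul_cancel₀ hl.ne', one_smul])
    have hl1 : l = 1 := le_antisymm (by rwa [one_le_inv₀ hl] at h2) h1
    obtain ⟨s, hs, hxs⟩ := hx.2
    have hw := (hK s hs).1.eq_zero_of_evalSum ht
      (((hK s hs).1.card_le ht (hK s hs).2).trans (Nat.le_succ m))
      (fun i hi => ?_) (hrel x hx y hy l h)
    · funext i
      have := congrFun hw i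
      simp only [hl1, Pi.zero_apply] at this
      linarith
    · simp only [hl1, hxs i hi]
      linarith [hy.1.1 i]

/-- In degree at most `r + 1` the kernel of `q` is a hyperplane, spanned by `h` and the `r`
corrected monomials. A functional vanishing on it is a multiple of `q`, with factor read off at 1.
-/
theorem evalSum_eq_mul_of_kernel {φ q : ℝ[X] →ₗ[ℝ] ℝ} {r : ℕ} {h : ℝ[X]}
    (hd : h.natDegree = r + 1) (hq : q h = 0) (hφ : φ h = 0) (hq1 : q 1 ≠ 0)
    (hX : ∀ j < r, φ (X ^ (j + 1) - C (q (X ^ (j + 1)) / q 1)) = 0)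
    (f : ℝ[X]) (hf : f.natDegree ≤ r + 1) : φ f = φ 1 / q 1 * q f := by
  set ψ : ℝ[X] →ₗ[ℝ] ℝ := φ - (φ 1 / q 1) • q with hψ
  have hC : ∀ a : ℝ, φ (C a) = a * φ 1 := fun a => by
    rw [← mul_one (C a), ← smul_eq_C_mul, map_smul, smul_eq_mul]
  have hpow : ∀ j < r + 1, ψ (X ^ j) = 0 := by
    intro j hj
    rcases j with _ | j
    · simp [hψ, div_mul_cancel₀ _ hq1]
    · have := hX j (by omega)
      rw [map_sub, hC] at this
      simp only [hψ, LinearMap.sub_apply, LinearMap.smul_apply, smul_eq_mul]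
      rw [sub_eq_zero.1 this]
      ring
  have hsum : ∀ g : ℝ[X], g.natDegree ≤ r + 1 → ψ g = g.coeff (r + 1) * ψ (X ^ (r + 1)) := by
    intro g hg
    conv_lhs => rw [g.as_sum_range_C_mul_X_pow' (Nat.lt_succ_of_le hg)]
    rw [map_sum, Finset.sum_range_succ, Finset.sum_eq_zero, zero_add, ← smul_eq_C_mul, map_smul,
      smul_eq_mul]
    intro j hj
    rw [← smul_eq_C_mul, map_smul, hpow j (Finset.mem_range.1 hj), smul_zero]
  have htop : ψ (X ^ (r + 1)) = 0 := by
    have h1 := hsum h hd.le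
    have h2 : ψ h = 0 := by simp [hψ, hq, hφ]
    rw [h2, zero_eq_mul] at h1
    refine h1.resolve_left ?_
    rw [← hd]
    exact leadingCoeff_ne_zero.2 (by rintro rfl; simp at hd)
  have h3 := hsum f hf
  rw [htop, mul_zero] at h3
  simpa [hψ, sub_eq_zero] using h3

/-- The Schlegel diagram: a complex of faces none of which contains a given facet `F` embeds
linearly, by central projection from a point just beyond `F`. -/
theorem linearlyEmbedsInto_of_facet {r : ℕ} (ht : Function.Injective t) (hn : r + 2 ≤ n)
    {F : Finset (Fin n)} (hF : IsGaleSet (r + 1) t F) (hFc : F.card = r + 1)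
    (hK : ∀ s ∈ K.faces, IsGaleSet (r + 1) t s ∧ s.card ≤ r + 2 ∧ ¬ F ⊆ s) :
    LinearlyEmbedsInto K r := by
  classical
  obtain ⟨gF, hgFd, hgF0, hgF⟩ := hF
  obtain ⟨j, hj⟩ : ∃ j, j ∉ F := by
    by_contra! h
    rw [Finset.eq_univ_iff_forall.2 h, Finset.card_fin] at hFc
    omega
  have hgFj : 0 < gF.eval (t j) := lt_of_le_of_ne (hgF0 j) fun h => hj ((hgF j).1 h.symm)
  have hgFd' : gF.natDegree = r + 1 := by
    refine le_antisymm hgFd ?_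
    rw [← hFc]
    exact card_le_natDegree_of_eval_eq_zero ht.injOn (by rintro rfl; simp at hgFj)
      fun i hi => (hgF i).2 hi
  have hwit : ∀ s : Finset (Fin n), ∃ f : ℝ[X], s ∈ K.faces → f.natDegree ≤ r + 1 ∧
      (∀ i, 0 ≤ f.eval (t i)) ∧ (∀ i, f.eval (t i) = 0 ↔ i ∈ s) := by
    intro s
    by_cases hs : s ∈ K.faces
    · obtain ⟨f, hf⟩ := (hK s hs).1
      exact ⟨f, fun _ => hf⟩
    · exact ⟨0, fun h => absurd h hs⟩
  choose g hg using hwit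
  -- Pushing the barycentre of `F` slightly away from the vertex `j` gives the projection centre.
  -- Since no face of `K` contains `F`, each face witness is positive at the barycentre, and a small
  -- `ε` keeps these finitely many inequalities. The bound `ε < r + 1` keeps the total mass `q 1`
  -- positive.
  obtain ⟨ε, hε, hεF, hεg⟩ : ∃ ε : ℝ, 0 < ε ∧ ε < r + 1 ∧ ∀ s ∈ K.faces,
      ε * (g s).eval (t j) < ∑ i ∈ F, (g s).eval (t i) := by
    have hlim : ∀ a b : ℝ, 0 < b → ∀ᶠ ε in nhdsWithin (0 : ℝ) (Set.Ioi 0), ε * a < b := by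
      intro a b hb
      have : Filter.Tendsto (fun ε : ℝ => ε * a) (nhdsWithin 0 (Set.Ioi 0)) (nhds (0 * a)) :=
        ((continuous_mul_const a).tendsto 0).mono_left nhdsWithin_le_nhds
      rw [zero_mul] at this
      exact this.eventually_lt_const hb
    have hall : ∀ᶠ ε in nhdsWithin (0 : ℝ) (Set.Ioi 0), ∀ s : Finset (Fin n), s ∈ K.faces →
        ε * (g s).eval (t j) < ∑ i ∈ F, (g s).eval (t i) := by
      refine Filter.eventually_all.2 fun s => ?_
      by_cases hs : s ∈ K.faces
      · obtain ⟨-, h0, hz⟩ := hg s hs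
        obtain ⟨i, hi, his⟩ := Finset.not_subset.1 (hK s hs).2.2
        have hpos : 0 < ∑ i ∈ F, (g s).eval (t i) := Finset.sum_pos' (fun i _ => h0 i)
          ⟨i, hi, lt_of_le_of_ne (h0 i) fun h => his ((hz i).1 h.symm)⟩
        exact (hlim _ _ hpos).mono fun ε h _ => h
      · exact Filter.Eventually.of_forall fun ε h => absurd h hs
    obtain ⟨ε, ⟨h1, h2⟩, h3⟩ := ((hall.and (hlim 1 (r + 1) (by positivity))).and
      self_mem_nhdsWithin).exists
    exact ⟨ε, h3, by simpa using h2, h1⟩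
  set q : ℝ[X] →ₗ[ℝ] ℝ := ∑ i ∈ F, leval (t i) - ε • leval (t j) with hqdef
  have hq : ∀ f : ℝ[X], q f = ∑ i ∈ F, f.eval (t i) - ε * f.eval (t j) := fun f => by
    simp [hqdef, leval]
  have hq1 : 0 < q 1 := by
    rw [hq]
    simp [hFc, hεF]
  have hqF : q gF < 0 := by
    rw [hq, Finset.sum_eq_zero fun i hi => (hgF i).2 hi]
    have := mul_pos hε hgFj
    linarith
  have hqg : ∀ s ∈ K.faces, 0 < q (g s) := fun s hs => by
    rw [hq]
    exact sub_pos.2 (hεg s hs)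
  -- The hyperplane parallel to `F` through the centre: `q h = 0`, while `h` is positive at all
  -- nodes because `q gF < 0`.
  set h : ℝ[X] := C (q 1) * gF + C (-q gF) with hh
  have hhd : h.natDegree = r + 1 := by
    rw [hh, natDegree_add_C, natDegree_C_mul hq1.ne', hgFd']
  have hqh : q h = 0 := by
    have : h = q 1 • gF + (-q gF) • 1 := by simp [hh, smul_eq_C_mul]
    rw [this, map_add, map_smul, map_smul, smul_eq_mul, smul_eq_mul]
    ring
  have hhpos : ∀ i, 0 < h.eval (t i) := fun i => by
    have := mul_nonneg hq1.le (hgF0 i)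
    simp only [hh, eval_add, eval_mul, eval_C]
    linarith
  -- Affine functions vanishing at the centre; the quotients `e k / h` are the coordinates of the
  -- central projection.
  set e : ℕ → ℝ[X] := fun k => X ^ (k + 1) - C (q (X ^ (k + 1)) / q 1) with he
  refine .of_injOn (fun i => WithLp.toLp 2 fun k : Fin r => (e k).eval (t i) / h.eval (t i))
    fun x hx y hy hxy => ?_
  -- Dividing by `h` clears denominators: the functional of `w` kills `h` and every `e k`, hence is
  -- a multiple `μ` of `q`.
  set w : Fin n → ℝ := fun i => (x i - y i) / h.eval (t i) with hw
  have hφh : evalSum t w h = 0 := by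
    have : ∀ i, w i * h.eval (t i) = x i - y i := fun i => div_mul_cancel₀ _ (hhpos i).ne'
    simp only [evalSum_apply, this, Finset.sum_sub_distrib, hx.1.2, hy.1.2, sub_self]
  have hφe : ∀ k < r, evalSum t w (e k) = 0 := by
    intro k hk
    have := congrArg (fun v : EuclideanSpace ℝ (Fin r) => v ⟨k, hk⟩) hxy
    simp only [WithLp.ofLp_sum, WithLp.ofLp_smul, Finset.sum_apply, Pi.smul_apply,
      smul_eq_mul, WithLp.ofLp_zero, Pi.zero_apply] at this
    rw [evalSum_apply, ← this]
    exact Finset.sum_congr rfl fun i _ => by simp only [hw]; ring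
  have hφ := evalSum_eq_mul_of_kernel hhd hqh hφh hq1.ne' hφe
  set μ := evalSum t w 1 / q 1 with hμdef
  obtain ⟨s, hs, hxs⟩ := hx.2
  obtain ⟨s', hs', hys⟩ := hy.2
  have hwx : ∀ i, i ∉ s → w i ≤ 0 := fun i hi => by
    refine div_nonpos_of_nonpos_of_nonneg ?_ (hhpos i).le
    rw [hxs i hi]
    linarith [hy.1.1 i]
  have hwy : ∀ i, i ∉ s' → 0 ≤ w i := fun i hi => by
    refine div_nonneg ?_ (hhpos i).le
    rw [hys i hi]
    linarith [hx.1.1 i]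
  -- `q` is positive on the face witnesses, so the signs of `w` off `s` and off `s'` bound `μ` from
  -- the two sides.
  have hμ1 : μ ≤ 0 := by
    obtain ⟨hd, h0, hz⟩ := hg s hs
    have h1 : evalSum t w (g s) ≤ 0 := by
      rw [evalSum_apply]
      refine Finset.sum_nonpos fun i _ => ?_
      by_cases hi : i ∈ s
      · rw [(hz i).2 hi, mul_zero]
      · exact mul_nonpos_of_nonpos_of_nonneg (hwx i hi) (h0 i)
    rw [hφ _ hd] at h1
    exact nonpos_of_mul_nonpos_left h1 (hqg s hs)
  have hμ2 : 0 ≤ μ := by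
    obtain ⟨hd, h0, hz⟩ := hg s' hs'
    have h1 : 0 ≤ evalSum t w (g s') := by
      rw [evalSum_apply]
      refine Finset.sum_nonneg fun i _ => ?_
      by_cases hi : i ∈ s'
      · rw [(hz i).2 hi, mul_zero]
      · exact mul_nonneg (hwy i hi) (h0 i)
    rw [hφ _ hd] at h1
    exact nonneg_of_mul_nonneg_left h1 (hqg s' hs')
  have hμ : μ = 0 := le_antisymm hμ1 hμ2
  have hw0 := (hK s hs).1.eq_zero_of_evalSum ht (hK s hs).2.1 hwx fun f hf => by
    rw [hφ f hf, hμ, zero_mul]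
  funext i
  have := congrFun hw0 i
  simp only [hw, Pi.zero_apply, div_eq_zero_iff, (hhpos i).ne', or_false] at this
  exact sub_eq_zero.1 this

end Embedding

/-! ### Faces of the cyclic polytope as Gale sets -/

section Faces

variable {m n : ℕ} {t : Fin n → ℝ} {s : Finset (Fin n)} {F : Set (EuclideanSpace ℝ (Fin m))}

theorem mem_cyclicPolytope_iff {x : EuclideanSpace ℝ (Fin m)} :
    x ∈ cyclicPolytope m t ↔ ∃ w ∈ stdSimplex ℝ (Fin n), ∑ i, w i • momentCurve m (t i) = x := by
  rw [cyclicPolytope, convexHull_range_eq_exists_affineCombination]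
  constructor
  · rintro ⟨s, w, hw, h1, rfl⟩
    classical
    refine ⟨fun i => if i ∈ s then w i else 0, ⟨fun i => ?_, ?_⟩, ?_⟩
    · dsimp only
      split_ifs with h
      exacts [hw i h, le_rfl]
    · simpa using h1
    · rw [s.affineCombination_eq_linear_combination _ _ h1]
      simp
  · rintro ⟨w, hw, rfl⟩
    exact ⟨Finset.univ, w, fun i _ => hw.1 i, hw.2,
      Finset.univ.affineCombination_eq_linear_combination _ _ hw.2⟩

theorem momentCurve_mem_cyclicPolytope (i : Fin n) : momentCurve m (t i) ∈ cyclicPolytope m t :=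
  subset_convexHull ℝ _ ⟨i, rfl⟩

/-- The part of a cyclic polytope where a functional is maximal is spanned by the vertices at which
it is maximal. -/
theorem maximizers_eq_convexHull (l : StrongDual ℝ (EuclideanSpace ℝ (Fin m))) {c : ℝ}
    (hl : ∀ i, l (momentCurve m (t i)) ≤ c) (hs : s.Nonempty)
    (hls : ∀ i, l (momentCurve m (t i)) = c ↔ i ∈ s) :
    {x ∈ cyclicPolytope m t | ∀ y ∈ cyclicPolytope m t, l y ≤ l x} =
      convexHull ℝ ((fun i => momentCurve m (t i)) '' (s : Set (Fin n))) := by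
  classical
  obtain ⟨k, hk⟩ := hs
  have hP : ∀ y ∈ cyclicPolytope m t, l y ≤ c := by
    have : cyclicPolytope m t ⊆ {y | l y ≤ c} := by
      refine convexHull_min ?_ (convex_halfSpace_le l.isLinear c)
      rintro _ ⟨i, rfl⟩
      exact hl i
    exact this
  ext x
  constructor
  · rintro ⟨hx, hmax⟩
    have hxc : c ≤ l x := (hls k).2 hk ▸ hmax _ (momentCurve_mem_cyclicPolytope k)
    obtain ⟨w, hw, rfl⟩ := mem_cyclicPolytope_iff.1 hx
    have hterm : ∀ i ∈ Finset.univ, 0 ≤ w i * (c - l (momentCurve m (t i))) := fun i _ =>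
      mul_nonneg (hw.1 i) (sub_nonneg.2 (hl i))
    have hzero : ∑ i, w i * (c - l (momentCurve m (t i))) = 0 := by
      refine le_antisymm ?_ (Finset.sum_nonneg hterm)
      simp only [map_sum, map_smul, smul_eq_mul] at hxc
      simp only [mul_sub, Finset.sum_sub_distrib, ← Finset.sum_mul, hw.2]
      linarith
    rw [Finset.sum_eq_zero_iff_of_nonneg hterm] at hzero
    have hoff : ∀ i, i ∉ s → w i = 0 := fun i hi =>
      (mul_eq_zero.1 (hzero i (Finset.mem_univ i))).resolve_right fun h =>
        hi ((hls i).1 (sub_eq_zero.1 h).symm)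
    -- Indices outside `s` carry weight zero, so their points may be replaced by the vertex `k` of
    -- `s`.
    refine mem_convexHull_of_exists_fintype w
      (fun i => momentCurve m (t (if i ∈ s then i else k))) hw.1 hw.2 (fun i => ?_) ?_
    · refine ⟨_, ?_, rfl⟩
      split_ifs with h
      exacts [h, hk]
    · refine Finset.sum_congr rfl fun i _ => ?_
      by_cases hi : i ∈ s
      · simp [hi]
      · simp [hoff i hi]
  · intro hx
    have hxP : x ∈ cyclicPolytope m t := by
      refine convexHull_mono ?_ hx
      rintro _ ⟨i, -, rfl⟩
      exact ⟨i, rfl⟩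
    refine ⟨hxP, fun y hy => (hP y hy).trans ?_⟩
    have : convexHull ℝ ((fun i => momentCurve m (t i)) '' (s : Set (Fin n))) ⊆ {y | c ≤ l y} := by
      refine convexHull_min ?_ (convex_halfSpace_ge l.isLinear c)
      rintro _ ⟨i, hi, rfl⟩
      exact ((hls i).2 hi).ge
    exact this hx

theorem exists_polynomial_of_dual (l : StrongDual ℝ (EuclideanSpace ℝ (Fin m))) :
    ∃ f : ℝ[X], f.natDegree ≤ m ∧ ∀ a, f.eval a = l (momentCurve m a) := by
  refine ⟨∑ j : Fin m, C (l (EuclideanSpace.single j 1)) * X ^ ((j : ℕ) + 1), ?_, fun a => ?_⟩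
  · refine natDegree_sum_le_of_forall_le _ _ fun j _ => (natDegree_C_mul_X_pow_le _ _).trans ?_
    exact j.2
  · have h : momentCurve m a = ∑ j : Fin m, a ^ ((j : ℕ) + 1) • EuclideanSpace.single j (1 : ℝ) := by
      ext i
      simp [momentCurve, Pi.single_apply]
    rw [h, map_sum, eval_finsetSum]
    refine Finset.sum_congr rfl fun j _ => ?_
    rw [map_smul, smul_eq_mul, eval_C_mul, eval_pow, eval_X, mul_comm]

theorem exists_dual_of_polynomial (f : ℝ[X]) (hf : f.natDegree ≤ m) :
    ∃ l : StrongDual ℝ (EuclideanSpace ℝ (Fin m)),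
      ∀ a, l (momentCurve m a) = f.eval a - f.coeff 0 := by
  refine ⟨∑ j : Fin m, f.coeff ((j : ℕ) + 1) • EuclideanSpace.proj j, fun a => ?_⟩
  rw [eval_eq_sum_range' (Nat.lt_succ_of_le hf), Finset.sum_range_succ']
  simp [momentCurve, Finset.sum_range]

/-- The maximum of the exposing functional over the vertices, minus the polynomial it induces, is a
witness. -/
theorem IsPolytopeFace.exists_isGaleSet (hF : IsPolytopeFace (cyclicPolytope m t) F) :
    ∃ s : Finset (Fin n), s.Nonempty ∧ IsGaleSet m t s ∧
      F = convexHull ℝ ((fun i => momentCurve m (t i)) '' (s : Set (Fin n))) ∧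
      ∀ i, i ∈ s ↔ momentCurve m (t i) ∈ F := by
  classical
  obtain ⟨hne, hexp⟩ := hF
  obtain ⟨l, hl⟩ := hexp hne
  obtain ⟨x, hx⟩ := hne
  have hn : Nonempty (Fin n) := by
    rw [hl] at hx
    obtain ⟨w, hw, -⟩ := mem_cyclicPolytope_iff.1 hx.1
    by_contra h
    rw [not_nonempty_iff] at h
    simpa using hw.2
  obtain ⟨k, -, hk⟩ := Finset.exists_max_image Finset.univ (fun i => l (momentCurve m (t i)))
    ⟨hn.some, Finset.mem_univ _⟩
  set s := Finset.univ.filter fun i => l (momentCurve m (t i)) = l (momentCurve m (t k)) with hs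
  have hmem : ∀ i, l (momentCurve m (t i)) = l (momentCurve m (t k)) ↔ i ∈ s := fun i => by
    simp [hs]
  have hne : s.Nonempty := ⟨k, (hmem k).1 rfl⟩
  have heq := maximizers_eq_convexHull l (fun i => hk i (Finset.mem_univ i)) hne hmem
  refine ⟨s, hne, ?_, hl.trans heq, fun i => ⟨fun hi => ?_, fun hi => ?_⟩⟩
  · obtain ⟨f, hfd, hf⟩ := exists_polynomial_of_dual l
    refine ⟨C (l (momentCurve m (t k))) - f, ?_, fun i => ?_, fun i => ?_⟩
    · exact (natDegree_sub_le _ _).trans (by simpa using hfd)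
    · rw [eval_sub, eval_C, hf, sub_nonneg]
      exact hk i (Finset.mem_univ i)
    · rw [eval_sub, eval_C, hf, sub_eq_zero, eq_comm]
      exact hmem i
  · rw [hl, heq]
    exact subset_convexHull ℝ _ ⟨i, hi, rfl⟩
  · rw [hl] at hi
    exact (hmem i).1 (le_antisymm (hk i (Finset.mem_univ i))
      (hi.2 _ (momentCurve_mem_cyclicPolytope k)))

theorem IsGaleSet.isPolytopeFace (hs : s.Nonempty) (h : IsGaleSet m t s) :
    IsPolytopeFace (cyclicPolytope m t)
      (convexHull ℝ ((fun i => momentCurve m (t i)) '' (s : Set (Fin n)))) ∧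
    ∀ i, i ∈ s ↔ momentCurve m (t i) ∈
      convexHull ℝ ((fun i => momentCurve m (t i)) '' (s : Set (Fin n))) := by
  obtain ⟨f, hfd, hf0, hf⟩ := h
  obtain ⟨l, hl⟩ := exists_dual_of_polynomial f hfd
  have hl0 : ∀ i, (-l) (momentCurve m (t i)) ≤ f.coeff 0 := fun i => by
    have := hf0 i
    rw [neg_apply, hl]
    linarith
  have hls : ∀ i, (-l) (momentCurve m (t i)) = f.coeff 0 ↔ i ∈ s := fun i => by
    rw [← hf i, neg_apply, hl]
    constructor <;> intro h <;> linarith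
  have heq := maximizers_eq_convexHull (-l) hl0 hs hls
  refine ⟨⟨(hs.to_set.image _).convexHull, fun _ => ⟨-l, heq.symm⟩⟩, fun i => ⟨fun hi => ?_, fun hi => ?_⟩⟩
  · exact subset_convexHull ℝ _ ⟨i, hi, rfl⟩
  · rw [← heq] at hi
    obtain ⟨k, hk⟩ := hs
    refine (hls i).1 (le_antisymm (hl0 i) ?_)
    have := hi.2 _ (momentCurve_mem_cyclicPolytope k)
    rwa [(hls k).2 hk] at this

theorem cyclicBoundary_eq :
    cyclicBoundary m t = {s | s.Nonempty ∧ s ≠ Finset.univ ∧ IsGaleSet m t s} := by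
  ext s
  constructor
  · rintro ⟨F, hF, hne, hs⟩
    obtain ⟨s', h1, h2, h3, h4⟩ := hF.exists_isGaleSet
    obtain rfl : s = s' := Finset.ext fun i => (hs i).trans (h4 i).symm
    refine ⟨h1, ?_, h2⟩
    rintro rfl
    refine hne ?_
    rw [h3, Finset.coe_univ, Set.image_univ, cyclicPolytope]
  · rintro ⟨h1, h2, h3⟩
    obtain ⟨h4, h5⟩ := h3.isPolytopeFace h1
    refine ⟨_, h4, fun h => h2 (Finset.eq_univ_iff_forall.2 fun i => ?_), h5⟩
    rw [h5 i, h]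
    exact momentCurve_mem_cyclicPolytope i

/-- A Gale set is recovered from its hull as the set of nodes lying in it, so distinct Gale sets
give distinct faces; below dimension `m`, dimension determines the number of vertices. -/
theorem polytopeFaceCount_cyclicPolytope (ht : Function.Injective t) {d : ℕ} (hd : d < m) :
    polytopeFaceCount (cyclicPolytope m t) d =
      {s : Finset (Fin n) | IsGaleSet m t s ∧ s.card = d + 1}.ncard := by
  rw [← Set.InjOn.ncard_image (f := fun s : Finset (Fin n) =>
    convexHull ℝ ((fun i => momentCurve m (t i)) '' (s : Set (Fin n))))]
  · rw [polytopeFaceCount]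
    congr 1
    ext F
    constructor
    · rintro ⟨hF, hFd⟩
      obtain ⟨s, h1, h2, rfl, h4⟩ := hF.exists_isGaleSet
      refine ⟨s, ⟨h2, ?_⟩, rfl⟩
      rwa [← direction_affineSpan, affineSpan_convexHull, direction_affineSpan,
        finrank_vectorSpan_momentCurve_eq_iff ht h1 hd] at hFd
    · rintro ⟨s, ⟨h1, h2⟩, rfl⟩
      have hne : s.Nonempty := Finset.card_pos.1 (by omega)
      refine ⟨(h1.isPolytopeFace hne).1, ?_⟩
      rwa [← direction_affineSpan, affineSpan_convexHull, direction_affineSpan,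
        finrank_vectorSpan_momentCurve_eq_iff ht hne hd]
  · rintro s ⟨h1, h2⟩ s' ⟨h3, h4⟩ h
    have h5 := (h1.isPolytopeFace (Finset.card_pos.1 (by omega))).2
    have h6 := (h3.isPolytopeFace (Finset.card_pos.1 (by omega))).2
    refine Finset.ext fun i => (h5 i).trans (Iff.trans ?_ (h6 i).symm)
    exact Set.ext_iff.1 h _

end Faces

/-! ### Complexes of faces, counting and growth -/

section Complexes

variable {n : ℕ}

theorem HasDimension.one_le_simplexCount {K : AbstractSimplicialComplex (Fin n)} {d : ℕ}
    (h : HasDimension K d) : 1 ≤ simplexCount K d := by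
  obtain ⟨s, hs, hsc⟩ := h.1
  exact (Set.ncard_pos (Set.toFinite _)).2 ⟨s, hs, hsc⟩

theorem exists_isGreatest_embeddableCounts {d : ℕ} {X : Type*} [TopologicalSpace X]
    {K : AbstractSimplicialComplex (Fin n)} (hK : HasDimension K d) (hX : EmbedsInto K X) :
    ∃ M, IsGreatest (embeddableCounts d n X) M ∧ simplexCount K d ≤ M := by
  have hmem : simplexCount K d ∈ embeddableCounts d n X := ⟨K, hK, hX, rfl⟩
  have hbdd : BddAbove (embeddableCounts d n X) := by
    refine ⟨Nat.card (Finset (Fin n)), ?_⟩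
    rintro _ ⟨L, -, -, rfl⟩
    exact Set.ncard_le_card _
  exact ⟨_, ⟨Nat.sSup_mem ⟨_, hmem⟩ hbdd, fun _ h => le_csSup hbdd h⟩, le_csSup hbdd hmem⟩

/-- The complex of all simplices on `n` vertices. -/
def fullSimplex (n : ℕ) : AbstractSimplicialComplex (Fin n) where
  faces := {s | s.Nonempty}
  isRelLowerSet_faces := fun _ hs => ⟨hs, fun _ _ ht => ht⟩
  singleton_mem v := Finset.singleton_nonempty v

theorem hasDimension_fullSimplex (d : ℕ) : HasDimension (fullSimplex (d + 1)) d :=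
  ⟨⟨Finset.univ, Finset.univ_nonempty, by simp⟩, fun s _ => by simpa using s.card_le_univ⟩

variable {m : ℕ} {t : Fin n → ℝ}

/-- The proper faces with at most `k` vertices of the polytope spanned by `n` points of the moment
curve in dimension `m`. -/
def galeComplex (ht : Function.Injective t) (hm : 2 ≤ m) (hn : m ≤ n) {k : ℕ} (hk : 1 ≤ k) :
    AbstractSimplicialComplex (Fin n) where
  faces := {s | (s.Nonempty ∧ s ≠ Finset.univ ∧ IsGaleSet m t s) ∧ s.card ≤ k}
  isRelLowerSet_faces := fun s ⟨⟨h1, h2, h3⟩, h4⟩ => ⟨h1, fun s' hs' hne => by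
    have hss : s' ⊆ s := hs'
    refine ⟨⟨hne, ?_, h3.subset ht ((h3.card_le ht h2).trans (Nat.le_succ m)) hss⟩,
      (Finset.card_le_card hss).trans h4⟩
    rintro rfl
    exact h2 (Finset.univ_subset_iff.1 hss)⟩
  singleton_mem v := by
    obtain ⟨T, hvT, hT, hG⟩ := IsGaleSet.exists_superset_card_eq ht hn (S := {v}) (k := 1)
      (by simpa using hm) (by simp) (by omega)
    obtain rfl := Finset.eq_of_subset_of_card_le hvT (by simp [hT])
    refine ⟨⟨Finset.singleton_nonempty v, fun h => ?_, hG⟩, by simpa using hk⟩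
    have := congrArg Finset.card h
    rw [Finset.card_singleton, Finset.card_fin] at this
    omega

/-- Double counting: each `k`-set lies in some Gale set of size `e`, which contains only `e.choose
k` of them. -/
theorem choose_le_ncard_mul_choose (ht : Function.Injective t) (hn : m ≤ n) {k e : ℕ}
    (hk : 2 * k ≤ m) (hke : k ≤ e) (hem : e ≤ m) :
    n.choose k ≤ {s : Finset (Fin n) | IsGaleSet m t s ∧ s.card = e}.ncard * e.choose k := by
  classical
  rw [Set.ncard_eq_toFinset_card']
  set G := {s : Finset (Fin n) | IsGaleSet m t s ∧ s.card = e}.toFinset with hG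
  have hsub : Finset.powersetCard k Finset.univ ⊆ G.biUnion (Finset.powersetCard k) := by
    intro S hS
    rw [Finset.mem_powersetCard] at hS
    obtain ⟨T, hST, hT, hTG⟩ := IsGaleSet.exists_superset_card_eq ht hn (S := S) (k := e)
      (by omega) (by omega) hem
    refine Finset.mem_biUnion.2 ⟨T, ?_, Finset.mem_powersetCard.2 ⟨hST, hS.2⟩⟩
    simp [hG, hTG, hT]
  have h1 := Finset.card_le_card hsub
  rw [Finset.card_powersetCard, Finset.card_fin] at h1
  refine h1.trans (Finset.card_biUnion_le_card_mul _ _ _ fun T hT => ?_)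
  have : T.card = e := by
    simp only [hG, Set.mem_toFinset, Set.mem_ofPred_eq] at hT
    exact hT.2
  rw [Finset.card_powersetCard, this]

/-- The bound `N / 2` instead of `N` leaves room for the loss of one facet; the condition at `N₀`
serves the case of a single simplex. -/
theorem exists_growth_constant (k e N₀ : ℕ) (hke : k ≤ e) :
    ∃ c : ℝ, 0 < c ∧ c * (N₀ : ℝ) ^ k ≤ 1 ∧ ∀ n N : ℕ, 2 * k ≤ n → n.choose k ≤ N * e.choose k →
      c * (n : ℝ) ^ k ≤ N / 2 := by
  have hch : (0 : ℝ) < e.choose k := by exact_mod_cast Nat.choose_pos hke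
  have hfac : (0 : ℝ) < (k.factorial : ℝ) := by exact_mod_cast k.factorial_pos
  set c₀ : ℝ := 1 / (2 ^ k * k.factorial * e.choose k * 2) with hc₀
  refine ⟨min c₀ (1 / ((N₀ : ℝ) ^ k + 1)), by positivity, ?_, fun n N hn hN => ?_⟩
  · have h0 : (0 : ℝ) ≤ (N₀ : ℝ) ^ k := by positivity
    calc min c₀ (1 / ((N₀ : ℝ) ^ k + 1)) * (N₀ : ℝ) ^ k
        ≤ 1 / ((N₀ : ℝ) ^ k + 1) * (N₀ : ℝ) ^ k := by gcongr; exact min_le_right _ _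
      _ ≤ 1 := by
        rw [one_div, inv_mul_le_iff₀ (by positivity)]
        linarith
  · have h1 := Nat.pow_le_choose (α := ℝ) k n
    have h2 : (n : ℝ) / 2 ≤ ((n + 1 - k : ℕ) : ℝ) := by
      rw [div_le_iff₀ two_pos]
      exact_mod_cast (by omega : n ≤ (n + 1 - k) * 2)
    have h3 : ((n : ℝ) / 2) ^ k ≤ N * e.choose k * k.factorial := by
      rw [div_le_iff₀ hfac] at h1
      refine (pow_le_pow_left₀ (by positivity) h2 k).trans (h1.trans ?_)
      gcongr
      exact_mod_cast hN
    rw [div_pow, div_le_iff₀ (by positivity)] at h3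
    calc min c₀ (1 / ((N₀ : ℝ) ^ k + 1)) * (n : ℝ) ^ k ≤ c₀ * (n : ℝ) ^ k := by
          gcongr; exact min_le_left _ _
      _ ≤ N / 2 := by
        rw [hc₀, one_div, inv_mul_le_iff₀ (by positivity)]
        linarith

theorem Nat.ceil_cast_div_two (r : ℕ) : ⌈(r : ℝ) / 2⌉₊ = (r + 1) / 2 := by
  refine le_antisymm (Nat.ceil_le.2 ?_) ?_
  · rw [div_le_iff₀ two_pos]
    exact_mod_cast (by omega : r ≤ (r + 1) / 2 * 2)
  · have h := Nat.le_ceil ((r : ℝ) / 2)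
    rw [div_le_iff₀ two_pos] at h
    have : r ≤ ⌈(r : ℝ) / 2⌉₊ * 2 := by exact_mod_cast h
    omega

/-- The skeleton of a cyclic polytope below the dimension of its facets. -/
theorem exists_skeleton_of_lt {d r : ℕ} (hd : 1 ≤ d) (hdr : d < r) (hn : r + 1 ≤ n)
    (ht : Function.Injective t) :
    ∃ K : AbstractSimplicialComplex (Fin n),
      K.faces = {s | s ∈ cyclicBoundary (r + 1) t ∧ s.card ≤ d + 1} ∧
      HasDimension K d ∧ LinearlyEmbedsInto K r ∧
      simplexCount K d = polytopeFaceCount (cyclicPolytope (r + 1) t) d := by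
  have hne : ∀ s : Finset (Fin n), s.card ≤ d + 1 → s ≠ Finset.univ := by
    rintro s hs rfl
    rw [Finset.card_fin] at hs
    omega
  refine ⟨galeComplex ht (m := r + 1) (by omega) hn (k := d + 1) (by omega), ?_, ⟨?_, ?_⟩, ?_, ?_⟩
  · rw [cyclicBoundary_eq]
    rfl
  · obtain ⟨T, -, hT, hG⟩ := IsGaleSet.exists_superset_card_eq ht hn (S := ∅) (k := d + 1)
      (by simp) (by simp) (by omega)
    exact ⟨T, ⟨⟨Finset.card_pos.1 (by omega), hne T hT.le, hG⟩, hT.le⟩, hT⟩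
  · exact fun s hs => hs.2
  · rcases hn.eq_or_lt with h | h
    · exact linearlyEmbedsInto_of_card_le h.ge
    -- Faces of the skeleton have at most `d + 1 ≤ r` vertices, so none contains a facet, and any
    -- facet can serve for the projection.
    · obtain ⟨F, -, hFc, hF⟩ := IsGaleSet.exists_facet_superset ht hn (S := ∅) (by simp)
      refine linearlyEmbedsInto_of_facet ht h hF hFc fun s hs => ⟨hs.1.2.2, ?_, fun hFs => ?_⟩
      · have := hs.2
        omega
      · have := Finset.card_le_card hFs
        have := hs.2
        omega
  · rw [polytopeFaceCount_cyclicPolytope ht (by omega), simplexCount]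
    congr 1
    ext s
    exact ⟨fun h => ⟨h.1.1.2.2, h.2⟩,
      fun h => ⟨⟨⟨Finset.card_pos.1 (by rw [h.2]; omega), hne s h.2.le, h.1⟩, h.2.le⟩, h.2⟩⟩

/-- The boundary complex of a cyclic polytope is a sphere, and a ball once a facet is removed. -/
theorem exists_boundary_complex {d : ℕ} (hd : 1 ≤ d) (hn : d + 2 ≤ n)
    (ht : Function.Injective t) :
    ∃ B : AbstractSimplicialComplex (Fin n),
      B.faces = cyclicBoundary (d + 1) t ∧
      HasDimension B d ∧
      EmbedsInto B (Metric.sphere (0 : EuclideanSpace ℝ (Fin (d + 1))) 1) ∧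
      simplexCount B d = polytopeFaceCount (cyclicPolytope (d + 1) t) d ∧
      ∀ F ∈ B.faces, F.card = d + 1 → ∃ L : AbstractSimplicialComplex (Fin n),
        L.faces = B.faces \ {F} ∧ HasDimension L d ∧ LinearlyEmbedsInto L d ∧
        simplexCount L d + 1 = polytopeFaceCount (cyclicPolytope (d + 1) t) d := by
  have hne : ∀ s : Finset (Fin n), s.card ≤ d + 1 → s ≠ Finset.univ := by
    rintro s hs rfl
    rw [Finset.card_fin] at hs
    omega
  have hn' : d + 1 ≤ n := by omega
  set B := galeComplex ht (m := d + 1) (by omega) hn' (k := d + 1) (by omega) with hB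
  have hmem : ∀ s, IsGaleSet (d + 1) t s → s.card = d + 1 → s ∈ B.faces := fun s h hs =>
    ⟨⟨Finset.card_pos.1 (by omega), hne s hs.le, h⟩, hs.le⟩
  have hcount : simplexCount B d = polytopeFaceCount (cyclicPolytope (d + 1) t) d := by
    rw [polytopeFaceCount_cyclicPolytope ht (by omega), simplexCount]
    congr 1
    ext s
    exact ⟨fun h => ⟨h.1.1.2.2, h.2⟩, fun h => ⟨hmem s h.1 h.2, h.2⟩⟩
  refine ⟨B, ?_, ⟨?_, fun s hs => hs.2⟩, ?_, hcount, fun F hF hFc => ?_⟩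
  · rw [cyclicBoundary_eq]
    ext s
    exact ⟨fun h => h.1, fun h => ⟨h, h.2.2.card_le ht h.2.1⟩⟩
  · obtain ⟨T, -, hT, hG⟩ := IsGaleSet.exists_facet_superset ht hn' (S := ∅) (by simp)
    exact ⟨T, hmem T hG hT, hT⟩
  · exact embedsInto_sphere_of_isGaleSet ht fun s hs => ⟨hs.1.2.2, hs.1.2.1⟩
  · refine ⟨⟨⟨B.faces \ {F}, ?_⟩, ?_⟩, rfl, ⟨?_, fun s hs => hs.1.2⟩, ?_, ?_⟩
    · rintro s ⟨hs, hsF⟩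
      refine ⟨hs.1.1, fun s' hs' hne' => ⟨(B.isRelLowerSet_faces hs).2 hs' hne', ?_⟩⟩
      rintro rfl
      exact hsF (Finset.eq_of_subset_of_card_le hs' (by rw [hFc]; exact hs.2)).symm
    · refine fun v => ⟨B.singleton_mem v, fun h => ?_⟩
      have := congrArg Finset.card (Set.mem_singleton_iff.1 h)
      rw [Finset.card_singleton] at this
      omega
    -- The dimension survives the removal: a facet through a vertex outside `F` differs from `F`.
    · obtain ⟨v, hv⟩ : ∃ v, v ∉ F := by
        by_contra! h
        exact hF.1.2.1 (Finset.eq_univ_iff_forall.2 h)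
      obtain ⟨T, hvT, hT, hG⟩ := IsGaleSet.exists_facet_superset ht hn' (S := {v})
        (by rw [Finset.card_singleton]; omega)
      refine ⟨T, ⟨hmem T hG hT, ?_⟩, hT⟩
      rintro rfl
      exact hv (Finset.singleton_subset_iff.1 hvT)
    · refine linearlyEmbedsInto_of_facet ht hn hF.1.2.2 hFc fun s hs =>
        ⟨hs.1.1.2.2, hs.1.2.trans (Nat.le_succ _), fun hFs => hs.2 ?_⟩
      exact (Finset.eq_of_subset_of_card_le hFs (by rw [hFc]; exact hs.1.2)).symm
    · rw [← hcount, simplexCount, simplexCount,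
        ← Set.ncard_sdiff_singleton_add_one (a := F) (s := {s | s ∈ B.faces ∧ s.card = d + 1})
          ⟨hF, hFc⟩]
      congr 2
      ext s
      exact ⟨fun h => ⟨⟨h.1.1, h.2⟩, h.1.2⟩, fun h => ⟨⟨h.1.1, h.2⟩, h.1.2⟩⟩

theorem choose_le_polytopeFaceCount_mul {d r k : ℕ} (hn : r + 1 ≤ n) (hdr : d ≤ r)
    (hk : 2 * k ≤ r + 1) (hkd : k ≤ d + 1) (ht : Function.Injective t) :
    n.choose k ≤ polytopeFaceCount (cyclicPolytope (r + 1) t) d * (d + 1).choose k := by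
  rw [polytopeFaceCount_cyclicPolytope ht (by omega)]
  exact choose_le_ncard_mul_choose ht hn hk hkd (by omega)

theorem polytopeFaceCount_self {d : ℕ} {t : Fin (d + 1) → ℝ} (ht : Function.Injective t) :
    polytopeFaceCount (cyclicPolytope (d + 1) t) d ≤ 1 := by
  rw [polytopeFaceCount_cyclicPolytope ht (by omega)]
  refine (Set.ncard_le_one_iff (Set.toFinite _)).2 fun {a b} ha hb => ?_
  rw [(Finset.card_eq_iff_eq_univ a).1 (by rw [ha.2, Fintype.card_fin]),
    (Finset.card_eq_iff_eq_univ b).1 (by rw [hb.2, Fintype.card_fin])]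

end Complexes

/-! ### The main theorem -/

theorem mainTheorem2 (d r : ℕ) (hd : 1 ≤ d) (hdr : d ≤ r) (hr : r ≤ 2 * d) :
    ∃ c : ℝ, 0 < c ∧ ∀ n : ℕ, r + 1 ≤ n → ∀ t : Fin n → ℝ, StrictMono t →
      -- growth of the face number of the cyclic polytope
      c * (n : ℝ) ^ ⌈(r : ℝ) / 2⌉₊ ≤ (polytopeFaceCount (cyclicPolytope (r + 1) t) d : ℝ) ∧
      -- the maximum over complexes that embed into `ℝ^r`
      (∃ M : ℕ, IsGreatest (embeddableCounts d n (EuclideanSpace ℝ (Fin r))) M ∧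
        (d < r → polytopeFaceCount (cyclicPolytope (r + 1) t) d ≤ M) ∧
        (d = r → polytopeFaceCount (cyclicPolytope (r + 1) t) d ≤ M + 1) ∧
        c * (n : ℝ) ^ ⌈(r : ℝ) / 2⌉₊ ≤ (M : ℝ)) ∧
      -- the same bounds are reached by linearly embeddable complexes
      (∃ K : AbstractSimplicialComplex (Fin n), HasDimension K d ∧ LinearlyEmbedsInto K r ∧
        (d < r → polytopeFaceCount (cyclicPolytope (r + 1) t) d ≤ simplexCount K d) ∧
        (d = r → polytopeFaceCount (cyclicPolytope (r + 1) t) d ≤ simplexCount K d + 1) ∧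
        c * (n : ℝ) ^ ⌈(r : ℝ) / 2⌉₊ ≤ (simplexCount K d : ℝ)) ∧
      -- for `d < r`: the `d`-skeleton of the boundary complex is such a complex
      (d < r → ∃ K : AbstractSimplicialComplex (Fin n),
        K.faces = {s | s ∈ cyclicBoundary (r + 1) t ∧ s.card ≤ d + 1} ∧
        HasDimension K d ∧ LinearlyEmbedsInto K r ∧
        simplexCount K d = polytopeFaceCount (cyclicPolytope (r + 1) t) d) ∧
      -- for `d = r`: the boundary complex embeds into `S^d`, and without a facet into `ℝ^d`
      (d = r → d + 2 ≤ n → ∃ B : AbstractSimplicialComplex (Fin n),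
        B.faces = cyclicBoundary (d + 1) t ∧
        HasDimension B d ∧
        EmbedsInto B (Metric.sphere (0 : EuclideanSpace ℝ (Fin (d + 1))) 1) ∧
        simplexCount B d = polytopeFaceCount (cyclicPolytope (d + 1) t) d ∧
        ∀ F ∈ B.faces, F.card = d + 1 → ∃ L : AbstractSimplicialComplex (Fin n),
          L.faces = B.faces \ {F} ∧ HasDimension L d ∧ LinearlyEmbedsInto L d ∧
          simplexCount L d + 1 = polytopeFaceCount (cyclicPolytope (d + 1) t) d) ∧
      -- for `d = r`: the maximum over complexes that embed into `S^d`
      (d = r → ∃ M : ℕ,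
        IsGreatest (embeddableCounts d n
          (Metric.sphere (0 : EuclideanSpace ℝ (Fin (d + 1))) 1)) M ∧
        polytopeFaceCount (cyclicPolytope (d + 1) t) d ≤ M ∧
        c * (n : ℝ) ^ ⌈(d : ℝ) / 2⌉₊ ≤ (M : ℝ)) := by
  -- The exponent `(r + 1) / 2` is `⌈r/2⌉`, at most `d + 1` since `r ≤ 2d`; `r + 1` is the smallest
  -- admissible `n`.
  obtain ⟨c, hc, hc1, hcg⟩ := exists_growth_constant ((r + 1) / 2) (d + 1) (r + 1) (by omega)
  refine ⟨c, hc, fun n hn t hmono => ?_⟩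
  have ht := hmono.injective
  set f := polytopeFaceCount (cyclicPolytope (r + 1) t) d with hf
  have hgrow : c * (n : ℝ) ^ ⌈(r : ℝ) / 2⌉₊ ≤ (f : ℝ) / 2 := by
    rw [Nat.ceil_cast_div_two]
    exact hcg n f (by omega) (choose_le_polytopeFaceCount_mul hn hdr (by omega) (by omega) ht)
  have hgrow' : c * (n : ℝ) ^ ⌈(r : ℝ) / 2⌉₊ ≤ f := by
    have : (0 : ℝ) ≤ f := Nat.cast_nonneg f
    linarith
  have hlin : ∃ K : AbstractSimplicialComplex (Fin n), HasDimension K d ∧ LinearlyEmbedsInto K r ∧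
      (d < r → f ≤ simplexCount K d) ∧ (d = r → f ≤ simplexCount K d + 1) ∧
      c * (n : ℝ) ^ ⌈(r : ℝ) / 2⌉₊ ≤ (simplexCount K d : ℝ) := by
    rcases hdr.lt_or_eq with hlt | rfl
    · obtain ⟨K, -, h1, h2, h3⟩ := exists_skeleton_of_lt hd hlt hn ht
      exact ⟨K, h1, h2, fun _ => h3.ge, fun h => absurd h hlt.ne, by rwa [h3]⟩
    rcases hn.eq_or_lt with rfl | hn2
    -- For `n = d + 1` the only `d`-face is the polytope itself, so the full simplex is used in
    -- place of a boundary with a facet removed.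
    · have h1 := (hasDimension_fullSimplex d).one_le_simplexCount
      refine ⟨fullSimplex (d + 1), hasDimension_fullSimplex d, linearlyEmbedsInto_of_card_le le_rfl,
        fun h => absurd h (lt_irrefl d), fun _ => ?_, ?_⟩
      · exact (polytopeFaceCount_self ht).trans (by omega)
      · rw [Nat.ceil_cast_div_two]
        exact hc1.trans (by exact_mod_cast h1)
    · obtain ⟨B, -, ⟨⟨F, hF, hFc⟩, -⟩, -, -, hB⟩ := exists_boundary_complex hd hn2 ht
      obtain ⟨L, -, h1, h2, h3⟩ := hB F hF hFc
      refine ⟨L, h1, h2, fun h => absurd h (lt_irrefl d), fun _ => h3.ge, hgrow.trans ?_⟩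
      -- As `L` keeps a `d`-simplex, `f ≥ 2`, hence `f / 2 ≤ f - 1`.
      have h4 : (1 : ℝ) ≤ simplexCount L d := by exact_mod_cast h1.one_le_simplexCount
      have h5 : (simplexCount L d : ℝ) + 1 = f := by exact_mod_cast h3
      linarith
  refine ⟨hgrow', ?_, hlin, fun h => exists_skeleton_of_lt hd h hn ht, ?_, ?_⟩
  · obtain ⟨K, h1, h2, h3, h4, h5⟩ := hlin
    obtain ⟨M, hM, hKM⟩ := exists_isGreatest_embeddableCounts h1 h2.embedsInto
    exact ⟨M, hM, fun h => (h3 h).trans hKM, fun h => (h4 h).trans (by omega),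
      h5.trans (by exact_mod_cast hKM)⟩
  · rintro rfl hn2
    exact exists_boundary_complex hd hn2 ht
  · rintro rfl
    obtain ⟨K, h1, h2, h3⟩ : ∃ K : AbstractSimplicialComplex (Fin n), HasDimension K d ∧
        EmbedsInto K (Metric.sphere (0 : EuclideanSpace ℝ (Fin (d + 1))) 1) ∧
        f ≤ simplexCount K d := by
      rcases hn.eq_or_lt with rfl | hn2
      · exact ⟨fullSimplex (d + 1), hasDimension_fullSimplex d, embedsInto_sphere_euclideanSpace,
          (polytopeFaceCount_self ht).trans (hasDimension_fullSimplex d).one_le_simplexCount⟩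
      · obtain ⟨B, -, h1, h2, h3, -⟩ := exists_boundary_complex hd hn2 ht
        exact ⟨B, h1, h2, h3.ge⟩
    obtain ⟨M, hM, hKM⟩ := exists_isGreatest_embeddableCounts h1 h2
    exact ⟨M, hM, h3.trans hKM, hgrow'.trans (by exact_mod_cast h3.trans hKM)⟩
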